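/- Let $X$ be a metrizable space and $\kappa$ an infinite cardinal. Write $\mathrm{Fin}(X)$ for the hyperspace of non-empty finite subsets of $X$ with the Vietoris topology. Suppose that $X$ is locally path-connected and nowhere locally compact (no point of $X$ has a compact neighborhood), and that every neighborhood of every point of $X$ has density $\ge \kappa$, the density of a space being the least cardinality of a dense subset of it. Then for every integer $n \ge 0$ the space $\mathrm{Fin}(X)$ has the $\kappa$-discrete $n$-cells property: for every open cover $\mathcal{U}$ of $\mathrm{Fin}(X)$ and every continuous map $f : \bigoplus_{\gamma<\kappa} A_\gamma \to \mathrm{Fin}(X)$ defined on the topological sum of $\kappa$ copies $A_\gamma = [0,1]^n$ of the $n$-cube, there is a continuous map $g : \bigoplus_{\gamma<\kappa} A_\gamma \to \mathrm{Fin}(X)$ such that for every point $z$ of the sum some $U \in \mathcal{U}$ contains both $f(z)$ and $g(z)$, and such that the indexed family $\{g(A_\gamma)\}_{\gamma<\kappa}$ is discrete in $\mathrm{Fin}(X)$, i.e. every point of $\mathrm{Fin}(X)$ has a neighborhood that meets $g(A_\gamma)$ for at most one index $\gamma$. -/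

import Mathlib

open Set Topology TopologicalSpace

/-- The hyperspace of non-empty finite subsets of `X`. -/
def FinHyperspace (X : Type*) : Type _ :=
  {A : Set X // A.Finite ∧ A.Nonempty}

/-- The hyperspace of non-empty finite subsets carries the Vietoris topology, that is, the
subspace topology inherited from the Vietoris topology on all subsets of `X`. -/
instance FinHyperspace.instTopologicalSpace (X : Type*) [TopologicalSpace X] :
    TopologicalSpace (FinHyperspace X) :=
  (TopologicalSpace.vietoris X).induced Subtype.val

/-- The density of a topological space: the least cardinality of a dense subset. -/
noncomputable def topDensity (Y : Type*) [TopologicalSpace Y] : Cardinal :=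
  sInf {c | ∃ D : Set Y, Dense D ∧ Cardinal.mk D = c}

/-- No point of the space has a compact neighborhood. -/
def NowhereLocallyCompact (X : Type*) [TopologicalSpace X] : Prop :=
  ∀ x : X, ∀ K ∈ 𝓝 x, ¬ IsCompact K

/-- `f` and `g` are `𝒰`-close: for every point some member of `𝒰` contains both values. -/
def CoverClose {Z Y : Type*} (𝒰 : Set (Set Y)) (f g : Z → Y) : Prop :=
  ∀ z, ∃ U ∈ 𝒰, f z ∈ U ∧ g z ∈ U

/-- An indexed family of subsets is discrete: every point of the space has a neighborhood which
meets the member for at most one index. -/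
def IsDiscreteFamily {Γ Y : Type*} [TopologicalSpace Y] (B : Γ → Set Y) : Prop :=
  ∀ y : Y, ∃ V ∈ 𝓝 y, {γ : Γ | (B γ ∩ V).Nonempty}.Subsingleton

universe u v

/-- The `κ`-discrete `n`-cells property of a space `Y`. The topological sum of `κ` copies of the
cube `[0,1]^n` is the sigma type over an index type of cardinality `κ`. -/
def DiscreteCellsProperty (κ : Cardinal.{u}) (n : ℕ) (Y : Type v) [TopologicalSpace Y] : Prop :=
  ∀ Γ : Type u, Cardinal.mk Γ = κ →
    ∀ 𝒰 : Set (Set Y), (∀ U ∈ 𝒰, IsOpen U) → ⋃₀ 𝒰 = univ →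
      ∀ f : C((Σ _ : Γ, (Fin n → unitInterval)), Y),
        ∃ g : C((Σ _ : Γ, (Fin n → unitInterval)), Y),
          CoverClose 𝒰 g f ∧
          IsDiscreteFamily (fun γ : Γ => range (fun t : Fin n → unitInterval => g ⟨γ, t⟩))

/-! In `Fin(X)` finite unions are available, so a map can be labelled by inserting marked points
into its values. For each scale `m` choose marks `τ m i x` within `2⁻ᵐ` of `x`, indexed by `i : Γ`,
such that every point has a neighborhood containing marks of only finitely many indices, whatever
`x` is (`exists_locallyFinite_marking`). This rests on finding locally finite families of `κ` points
in every ball (`exists_locallyFinitePoints_ball`).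

The cover is replaced by a slowly varying scale `k`. By `exists_near_marked`, the restriction of `f`
to the cube `γ` can be moved, for any `i`, by less than that scale to a map each of whose values
contains a mark of index `i`. Its proof takes unions of paths between finite sets, so it uses only
compactness of the cube, not its dimension.

Near a given finite set only finitely many indices occur as marks, and hence also along a compact
image. A transfinite choice of distinct indices `σ γ` therefore makes the images pairwise disjoint
as well as locally finite; being compact, they form a discrete family. -/

section

open Metric

namespace FinHyperspace

/-! ### The Vietoris topology on finite sets in metric terms -/

section Near

variable {X : Type*} [MetricSpace X]

/-- Two finite sets are `r`-near if each lies in the open `r`-neighborhood of the other. -/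
def Near (r : ℝ) (A B : FinHyperspace X) : Prop :=
  (∀ a ∈ A.1, ∃ b ∈ B.1, dist a b < r) ∧ ∀ b ∈ B.1, ∃ a ∈ A.1, dist a b < r

theorem Near.symm {r : ℝ} {A B : FinHyperspace X} (h : Near r A B) : Near r B A :=
  ⟨fun b hb => by simpa only [dist_comm] using h.2 b hb,
    fun a ha => by simpa only [dist_comm] using h.1 a ha⟩

theorem Near.trans {r s : ℝ} {A B C : FinHyperspace X} (h : Near r A B) (h' : Near s B C) :
    Near (r + s) A C := by
  constructor
  · intro a ha
    obtain ⟨b, hb, hab⟩ := h.1 a ha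
    obtain ⟨c, hc, hbc⟩ := h'.1 b hb
    exact ⟨c, hc, (dist_triangle a b c).trans_lt (add_lt_add hab hbc)⟩
  · intro c hc
    obtain ⟨b, hb, hbc⟩ := h'.2 c hc
    obtain ⟨a, ha, hab⟩ := h.2 b hb
    exact ⟨a, ha, (dist_triangle a b c).trans_lt (add_lt_add hab hbc)⟩

theorem Near.mono {r s : ℝ} (hrs : r ≤ s) {A B : FinHyperspace X} (h : Near r A B) :
    Near s A B :=
  ⟨fun a ha => (h.1 a ha).imp fun _ hb => ⟨hb.1, hb.2.trans_le hrs⟩,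
    fun b hb => (h.2 b hb).imp fun _ ha => ⟨ha.1, ha.2.trans_le hrs⟩⟩

theorem near_refl {r : ℝ} (hr : 0 < r) (A : FinHyperspace X) : Near r A A :=
  ⟨fun a ha => ⟨a, ha, by simpa⟩, fun a ha => ⟨a, ha, by simpa⟩⟩

/-- At a compact set, in particular at a finite one, the Hausdorff uniformity and the Vietoris
topology have the same neighborhoods. -/
theorem nhds_basis_near (A : FinHyperspace X) :
    (𝓝 A).HasBasis (fun r : ℝ => 0 < r) fun r => {B | Near r A B} := by
  have h : (@nhds _ (TopologicalSpace.vietoris X) A.1).HasBasis (fun r : ℝ => 0 < r)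
      fun r => {B | (A.1, B) ∈ hausdorffEntourage {p : X × X | dist p.1 p.2 < r}} := by
    let _ := UniformSpace.hausdorff X
    rw [← A.2.1.isCompact.nhds_hausdorff_eq_nhds_vietoris]
    exact nhds_basis_uniformity' (uniformity_basis_dist (α := X)).uniformity_hausdorff
  rw [show 𝓝 A = _ from @nhds_induced _ _ (TopologicalSpace.vietoris X) Subtype.val A]
  exact h.comap _

theorem near_mem_nhds {r : ℝ} (hr : 0 < r) (A : FinHyperspace X) : {B | Near r A B} ∈ 𝓝 A :=
  (nhds_basis_near A).mem_of_mem hr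

instance : T2Space (FinHyperspace X) := by
  let F : FinHyperspace X → NonemptyCompacts X := fun A => ⟨⟨A.1, A.2.1.isCompact⟩, A.2.2⟩
  have hF : Continuous F := continuous_induced_rng.2 continuous_induced_dom
  exact .of_injective_continuous (f := F)
    (fun A B h => Subtype.ext (congrArg (fun C : NonemptyCompacts X => (C : Set X)) h)) hF

end Near

/-! ### Continuous unions and gluing along paths -/

section Vietoris

attribute [local instance] TopologicalSpace.vietoris

theorem _root_.Continuous.vietoris_union {K X : Type*} [TopologicalSpace K] [TopologicalSpace X]
    {F G : K → Set X} (hF : Continuous F) (hG : Continuous G) :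
    Continuous fun z => F z ∪ G z :=
  vietoris.continuous_union.comp (hF.prodMk hG)

theorem _root_.Set.Finite.continuous_vietoris_biUnion {K X ι : Type*} [TopologicalSpace K]
    [TopologicalSpace X] {s : Set ι} (hs : s.Finite) {F : ι → K → Set X}
    (hF : ∀ i ∈ s, Continuous (F i)) : Continuous fun z => ⋃ i ∈ s, F i z := by
  induction s, hs using Set.Finite.induction_on with
  | empty => simpa using continuous_const
  | @insert a s _ _ ih =>
    simp only [biUnion_insert]
    exact (hF a (mem_insert a s)).vietoris_union (ih fun i hi => hF i (mem_insert_of_mem a hi))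

/-- A finite set can be moved continuously within `Set X` until it contains another finite set,
provided each point of the latter is joined by a short path to a point of the former. -/
theorem exists_path_of_joinedIn {X : Type*} [MetricSpace X] {T S : Set X} (hT : T.Finite)
    (hS : S.Finite) {r : ℝ} (hr : 0 < r) (h : ∀ y ∈ S, ∃ x ∈ T, JoinedIn (ball x r) x y) :
    ∃ P : unitInterval → Set X, Continuous P ∧ P 0 = T ∧ S ⊆ P 1 ∧
      ∀ s, T ⊆ P s ∧ (P s).Finite ∧ ∀ p ∈ P s, ∃ x ∈ T, dist p x < r := by
  choose! c hcT hc using h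
  classical
  let q : X → unitInterval → X := fun y => if hy : y ∈ S then (hc y hy).somePath else fun _ => y
  have q_eq : ∀ y (hy : y ∈ S), q y = (hc y hy).somePath := fun y hy => dif_pos hy
  refine ⟨fun s => T ∪ ⋃ y ∈ S, {q y s}, ?_, ?_, ?_, fun s => ⟨subset_union_left, ?_, ?_⟩⟩
  · refine continuous_const.vietoris_union (hS.continuous_vietoris_biUnion fun y hy => ?_)
    rw [q_eq y hy]
    exact vietoris.isEmbedding_singleton.continuous.comp (map_continuous _)
  · refine union_eq_left.2 (iUnion₂_subset fun y hy => ?_)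
    rw [q_eq y hy]
    simpa using hcT y hy
  · intro y hy
    refine Or.inr (mem_iUnion₂_of_mem hy ?_)
    rw [q_eq y hy]
    simp
  · exact hT.union (hS.biUnion fun y _ => finite_singleton _)
  · rintro p (hp | hp)
    · exact ⟨p, hp, by simpa⟩
    · obtain ⟨y, hy, rfl⟩ := mem_iUnion₂.1 hp
      refine ⟨c y, hcT y hy, ?_⟩
      rw [q_eq y hy]
      exact (hc y hy).somePath_mem s

/-- Gluing constant finite sets `T v` along paths `P v w` from `T v` to a superset of `T w`. -/
theorem continuous_iUnion_paths {K X ι : Type*} [TopologicalSpace K] [TopologicalSpace X]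
    [Finite ι] {α β : ι → K → unitInterval} (hα : ∀ v, Continuous (α v))
    (hβ : ∀ v, Continuous (β v)) (hα_one : ∀ z, ∃ v, α v z = 1)
    (hαβ : ∀ v z, α v z = 0 ∨ β v z = 1) {T : ι → Set X} {P : ι → ι → unitInterval → Set X}
    (hP : ∀ v w, Continuous (P v w)) (hP_zero : ∀ v w, P v w 0 = T v)
    (hP_one : ∀ v w z, α v z = 1 → β w z = 1 → T w ⊆ P v w 1) :
    Continuous fun z => ⋃ v ∈ {v | β v z = 1}, ⋃ w ∈ (univ : Set ι), P v w (α v z ⊓ β w z) := by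
  -- The index set of the outer union jumps with `z`. On each of these finitely many closed sets the
  -- union over the fixed index set `M` gives the same value.
  let C : Set ι → Set K := fun M => {z | (∀ v ∈ M, β v z = 1) ∧ ∀ v ∉ M, α v z = 0}
  have hC : ∀ M, IsClosed (C M) := fun M =>
    (isClosed_biInter (s := M) (f := fun v => {z | β v z = 1}) fun v _ =>
      isClosed_eq (hβ v) continuous_const).inter
      (isClosed_biInter (s := Mᶜ) (f := fun v => {z | α v z = 0}) fun v _ =>
        isClosed_eq (hα v) continuous_const) |> fun h => by
      convert h using 1
      ext z
      simp [C]
  refine (locallyFinite_of_finite C).continuous (eq_univ_of_forall fun z => ?_) hC fun M => ?_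
  · exact mem_iUnion.2 ⟨{v | β v z = 1}, fun v hv => hv, fun v hv => (hαβ v z).resolve_right hv⟩
  · have hcont : Continuous fun z => ⋃ v ∈ M, ⋃ w ∈ (univ : Set ι), P v w (α v z ⊓ β w z) :=
      M.toFinite.continuous_vietoris_biUnion fun v _ =>
        finite_univ.continuous_vietoris_biUnion fun w _ => (hP v w).comp ((hα v).inf (hβ w))
    refine hcont.continuousOn.congr fun z hz => ?_
    refine subset_antisymm ?_ (biUnion_subset_biUnion_left hz.1)
    refine iUnion₂_subset fun v hv => ?_
    by_cases hvM : v ∈ M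
    · exact subset_biUnion_of_mem (u := fun v => ⋃ w ∈ (univ : Set ι), P v w (α v z ⊓ β w z)) hvM
    -- An index `v ∉ M` has `α v z = 0`, so its paths are still at `T v`, which the path from `v'`
    -- to `v` has already absorbed at time `1`.
    obtain ⟨v', hv'⟩ := hα_one z
    have hv'M : v' ∈ M := by
      by_contra h
      exact zero_ne_one ((hz.2 v' h).symm.trans hv')
    refine iUnion₂_subset fun w _ => ?_
    have h1 : α v z ⊓ β w z = 0 := by rw [hz.2 v hvM]; exact bot_inf_eq _
    rw [h1, hP_zero]
    refine (hP_one v' v z hv' hv).trans ?_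
    have h2 : α v' z ⊓ β v z = 1 := by rw [hv', show β v z = 1 from hv]; exact inf_idem _
    rw [← h2]
    exact subset_biUnion_of_mem (u := fun v => ⋃ w ∈ (univ : Set ι), P v w (α v z ⊓ β w z)) hv'M
      |>.trans' (subset_biUnion_of_mem (u := fun w => P v' w (α v' z ⊓ β w z)) (mem_univ v))

end Vietoris

end FinHyperspace

/-! ### A compatible metric with path-joined balls -/

/-- The infimum of the diameters of the path-connected sets containing two given points, truncated
at `1`, is a distance that dominates `min (dist x y) 1`. -/
theorem exists_pathDist (X : Type*) [MetricSpace X] [LocallyPathConnectedSpace X] :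
    ∃ D : X → X → ℝ, (∀ x, D x x = 0) ∧ (∀ x y, D x y = D y x) ∧
      (∀ x y z, D x z ≤ D x y + D y z) ∧ (∀ x y, min (dist x y) 1 ≤ D x y) ∧
      (∀ x, ∀ ε > 0, ∃ δ > 0, ∀ y, dist y x < δ → D x y < ε) ∧
      ∀ x y, ∀ r ≤ 1, D x y < r → JoinedIn {z | D x z < r} x y := by
  -- Admitting every `r ≥ 1` truncates the infimum at `1` and keeps the set nonempty when no
  -- path-connected set contains both points.
  let S : X → X → Set ℝ := fun x y => {r | 0 ≤ r ∧ (1 ≤ r ∨ ∃ C : Set X, IsPathConnected C ∧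
    x ∈ C ∧ y ∈ C ∧ ∀ a ∈ C, ∀ b ∈ C, dist a b ≤ r)}
  have S_one : ∀ x y, (1 : ℝ) ∈ S x y := fun x y => ⟨zero_le_one, .inl le_rfl⟩
  have S_bdd : ∀ x y, BddBelow (S x y) := fun x y => ⟨0, fun r hr => hr.1⟩
  have S_lt : ∀ x y r, sInf (S x y) < r → ∃ s ∈ S x y, s < r := fun x y r h =>
    exists_lt_of_csInf_lt ⟨1, S_one x y⟩ h
  have S_add : ∀ x y z r s, r ∈ S x y → s ∈ S y z → r + s ∈ S x z := by
    rintro x y z r s ⟨hr, hr'⟩ ⟨hs, hs'⟩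
    refine ⟨add_nonneg hr hs, ?_⟩
    rcases hr' with hr' | ⟨C, hC, hxC, hyC, hCd⟩
    · exact .inl (by linarith)
    rcases hs' with hs' | ⟨D, hD, hyD, hzD, hDd⟩
    · exact .inl (by linarith)
    refine .inr ⟨C ∪ D, hC.union hD ⟨y, hyC, hyD⟩, .inl hxC, .inr hzD, ?_⟩
    rintro a (ha | ha) b (hb | hb)
    · linarith [hCd a ha b hb]
    · linarith [dist_triangle a y b, hCd a ha y hyC, hDd y hyD b hb]
    · linarith [dist_triangle a y b, hDd a ha y hyD, hCd y hyC b hb]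
    · linarith [hDd a ha b hb]
  refine ⟨fun x y => sInf (S x y), fun x => ?_, fun x y => ?_, fun x y z => ?_, fun x y => ?_,
    fun x ε hε => ?_, fun x y r hr hxy => ?_⟩
  · exact le_antisymm
      (csInf_le (S_bdd x x) ⟨le_rfl, .inr ⟨{x}, isPathConnected_singleton x, rfl, rfl, by simp⟩⟩)
      (le_csInf ⟨1, S_one x x⟩ fun r hr => hr.1)
  · exact congrArg sInf <| Set.ext fun r =>
      and_congr_right fun _ => or_congr_right <| exists_congr fun C => by tauto
  · refine le_of_forall_pos_lt_add fun ε hε => ?_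
    obtain ⟨r, hr, hr'⟩ := S_lt x y (sInf (S x y) + ε / 2) (by linarith)
    obtain ⟨s, hs, hs'⟩ := S_lt y z (sInf (S y z) + ε / 2) (by linarith)
    linarith [csInf_le (S_bdd x z) (S_add x y z r s hr hs)]
  · refine le_csInf ⟨1, S_one x y⟩ ?_
    rintro r ⟨-, hr | ⟨C, -, hx, hy, hC⟩⟩
    · exact (min_le_right _ _).trans hr
    · exact (min_le_left _ _).trans (hC x hx y hy)
  · obtain ⟨C, ⟨hCx, hC⟩, hCε⟩ := (LocallyPathConnectedSpace.path_connected_basis x).mem_iff.1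
      (ball_mem_nhds x (show 0 < ε / 4 by linarith))
    obtain ⟨δ, hδ, hδC⟩ := Metric.mem_nhds_iff.1 hCx
    refine ⟨δ, hδ, fun y hy => lt_of_le_of_lt (csInf_le (S_bdd x y) (a := ε / 2) ⟨by linarith,
      .inr ⟨C, hC, mem_of_mem_nhds hCx, hδC hy, fun a ha b hb => ?_⟩⟩) (by linarith)⟩
    linarith [dist_triangle_right a b x, mem_ball.1 (hCε ha), mem_ball.1 (hCε hb)]
  · obtain ⟨s, ⟨hs, hs1 | ⟨C, hC, hx, hy, hCd⟩⟩, hsr⟩ := S_lt x y r hxy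
    · linarith
    · exact (hC.joinedIn x hx y hy).mono fun z hz =>
        lt_of_le_of_lt (csInf_le (S_bdd x z) ⟨hs, .inr ⟨C, hC, hx, hz, hCd⟩⟩) hsr

/-- A locally path-connected metrizable space has a compatible metric in which any two points at
distance `< r ≤ 1` are joined by a path inside the ball of radius `r`. -/
theorem exists_metricSpace_joinedIn_ball (X : Type*) [t : TopologicalSpace X] [MetrizableSpace X]
    [LocallyPathConnectedSpace X] :
    ∃ m : MetricSpace X, m.toUniformSpace.toTopologicalSpace = t ∧
      ∀ x y : X, ∀ r ≤ 1, dist x y < r → JoinedIn (ball x r) x y := by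
  obtain ⟨d, rfl⟩ : ∃ d : MetricSpace X, d.toUniformSpace.toTopologicalSpace = t :=
    ⟨metrizableSpaceMetric X, rfl⟩
  obtain ⟨D, D_self, D_comm, D_tri, D_ge, D_cont, D_path⟩ := exists_pathDist X
  let ρ : PseudoMetricSpace X :=
    { dist := D
      dist_self := D_self
      dist_comm := D_comm
      dist_triangle := D_tri }
  have top_eq : ρ.toUniformSpace.toTopologicalSpace = d.toUniformSpace.toTopologicalSpace := by
    refine TopologicalSpace.ext_nhds fun x => ?_
    refine (@nhds_basis_ball X ρ x).ext (@nhds_basis_ball X d.toPseudoMetricSpace x) ?_ ?_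
    · intro ε hε
      obtain ⟨δ, hδ, h⟩ := D_cont x ε hε
      exact ⟨δ, hδ, fun y hy => (D_comm y x).trans_lt (h y hy)⟩
    · intro ε hε
      refine ⟨min ε 1, lt_min hε one_pos, fun y hy => ?_⟩
      have h : D y x < min ε 1 := hy
      have h' := (D_ge y x).trans_lt h
      rcases min_lt_iff.1 h' with h' | h'
      · exact h'.trans_le (min_le_left _ _)
      · exact absurd h' (not_lt.2 (min_le_right _ _))
  have D_eq : ∀ x y, D x y = 0 → x = y := fun x y h => by
    have h' := D_ge x y
    rw [h] at h'
    rcases min_le_iff.1 h' with h' | h'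
    · exact dist_le_zero.1 h'
    · exact absurd h' (not_le.2 one_pos)
  refine ⟨{ ρ with eq_of_dist_eq_zero := fun {x y} => D_eq x y }, top_eq, fun x y r hr hxy => ?_⟩
  have hball : {z | D x z < r} = @ball X ρ x r := Set.ext fun z => by
    rw [mem_ofPred_eq, D_comm]; rfl
  have := D_path x y r hr hxy
  rw [hball] at this
  convert this

/-! ### Approximation by marked maps -/

namespace FinHyperspace

/-- The key approximation: a map from a compact space into the finite subsets of `X` is close, with
respect to a prescribed scale `k`, to a map all of whose values contain marked points `τ m x` of
bounded index `m`. -/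
theorem exists_near_marked {X K : Type*} [MetricSpace X] [PseudoMetricSpace K] [CompactSpace K]
    (hX : ∀ x y : X, ∀ r ≤ 1, dist x y < r → JoinedIn (ball x r) x y)
    {k : FinHyperspace X → ℕ}
    (hk : ∀ A B, Near ((1 / 2) ^ (k A + 1)) A B → k B ≤ k A + 1)
    {τ : ℕ → X → X} (hτ : ∀ m x, dist x (τ m x) < (1 / 2) ^ m)
    {f : K → FinHyperspace X} (hf : Continuous f) :
    ∃ h : K → FinHyperspace X, Continuous h ∧
      (∀ z, Near ((1 / 2) ^ (k (f z) + 1)) (f z) (h z)) ∧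
      ∀ z, ∃ m ≤ k (f z) + 7, ∃ x, τ m x ∈ (h z).1 := by
  let e : K → ℝ := fun z => (1 / 2) ^ k (f z)
  have e_pos : ∀ z, 0 < e z := fun z => by positivity
  have e_le_one : ∀ z, e z ≤ 1 := fun z => pow_le_one₀ (by norm_num) (by norm_num)
  -- the scale is bounded along `f`
  obtain ⟨N, hN⟩ : ∃ N, ∀ z, k (f z) ≤ N := by
    have hU : ∀ z : K, {w | k (f w) ≤ k (f z) + 1} ∈ 𝓝 z := fun z => by
      filter_upwards [hf.continuousAt (near_mem_nhds (r := (1 / 2) ^ (k (f z) + 1))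
        (by positivity) (f z))] with w hw using hk _ _ hw
    obtain ⟨t, ht⟩ := CompactSpace.elim_nhds_subcover _ hU
    refine ⟨t.sup fun z => k (f z) + 1, fun w => ?_⟩
    obtain ⟨z, hz, hw⟩ := mem_iUnion₂.1 (ht.ge (mem_univ w))
    exact le_trans hw (Finset.le_sup (f := fun z => k (f z) + 1) hz)
  let E : ℝ := (1 / 2) ^ N
  have E_pos : 0 < E := by positivity
  have E_le : ∀ z, E ≤ e z := fun z => pow_le_pow_of_le_one (by norm_num) (by norm_num) (hN z)
  -- uniform continuity of `f`
  obtain ⟨η, hη, hfη⟩ : ∃ η > 0, ∀ z w, dist z w < 4 * η → Near (E / 64) (f z) (f w) := by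
    obtain ⟨δ, hδ, h⟩ := lebesgue_number_lemma_of_metric isCompact_univ
      (c := fun z => interior (f ⁻¹' {B | Near (E / 128) (f z) B})) (fun _ => isOpen_interior)
      fun z _ => mem_iUnion.2 ⟨z, mem_interior_iff_mem_nhds.2 <|
        hf.continuousAt (near_mem_nhds (by positivity) (f z))⟩
    refine ⟨δ / 4, by positivity, fun z w hzw => ?_⟩
    obtain ⟨y, hy⟩ := h z (mem_univ z)
    have hy' := hy.trans interior_subset
    have h1 : Near (E / 128) (f y) (f z) := hy' (mem_ball_self hδ)
    have h2 : Near (E / 128) (f y) (f w) := hy' (by rw [mem_ball']; linarith)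
    exact (h1.symm.trans h2).mono (by linarith)
  have e_le : ∀ z w, dist z w < 4 * η → e z ≤ 2 * e w := fun z w hzw => by
    have h1 : k (f w) ≤ k (f z) + 1 := hk _ _ <| (hfη z w hzw).mono <| by
      have := E_le z
      simp only [e] at this
      rw [pow_succ]
      linarith
    have h2 : ((1 : ℝ) / 2) ^ (k (f z) + 1) ≤ (1 / 2) ^ k (f w) :=
      pow_le_pow_of_le_one (by norm_num) (by norm_num) h1
    rw [pow_succ] at h2
    simp only [e]
    linarith
  -- The shift `6` puts marks within `e v / 64` of `f v`. As `k` changes by at most one over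
  -- distances `< 4 * η`, the index is at most `k (f z) + 7` for nearby `z`.
  let T : K → Set X := fun v => τ (k (f v) + 6) '' (f v).1
  have T_fin : ∀ v, (T v).Finite := fun v => (f v).2.1.image _
  have τ_dist : ∀ v x, dist x (τ (k (f v) + 6) x) < e v / 64 := fun v x => by
    refine (hτ _ x).trans_eq ?_
    simp only [e, pow_add]
    ring
  -- paths between the sets of marked points
  have hP : ∀ v w, ∃ P : unitInterval → Set X, Continuous[_, TopologicalSpace.vietoris X] P ∧
      P 0 = T v ∧ (dist v w < 4 * η → T w ⊆ P 1) ∧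
      ∀ s, T v ⊆ P s ∧ (P s).Finite ∧ ∀ p ∈ P s, ∃ x ∈ T v, dist p x < e v / 16 := by
    intro v w
    by_cases hvw : dist v w < 4 * η
    · obtain ⟨P, hP1, hP2, hP3, hP4⟩ := exists_path_of_joinedIn (T_fin v) (T_fin w)
        (r := e v / 16) (by linarith [e_pos v]) <| by
          rintro _ ⟨b, hb, rfl⟩
          obtain ⟨a, ha, hab⟩ := (hfη v w hvw).2 b hb
          refine ⟨_, mem_image_of_mem _ ha, hX _ _ _ (by linarith [e_le_one v]) ?_⟩
          have h1 := τ_dist v a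
          have h2 := τ_dist w b
          have h3 := e_le w v (by rwa [dist_comm])
          have h4 := E_le v
          have h5 := dist_triangle4 (τ (k (f v) + 6) a) a b (τ (k (f w) + 6) b)
          rw [dist_comm _ a] at h5
          linarith
      exact ⟨P, hP1, hP2, fun _ => hP3, hP4⟩
    · exact ⟨fun _ => T v, @continuous_const _ _ _ (TopologicalSpace.vietoris X) _, rfl,
        fun h => absurd h hvw,
        fun s => ⟨subset_rfl, T_fin v, fun p hp => ⟨p, hp, by simpa using e_pos v⟩⟩⟩
  choose P P_cont P_zero P_one P_near using hP
  obtain ⟨t, -, ht_fin, ht⟩ := finite_cover_balls_of_compact (isCompact_univ (X := K)) hη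
  have : Finite t := ht_fin
  -- `α v` falls from `1` to `0` as the distance to `v` goes from `η` to `2 * η`, and `β v` does so
  -- from `2 * η` to `3 * η`; thus `β v` is still `1` wherever `α v` is nonzero.
  let α : t → K → unitInterval := fun v z => projIcc 0 1 zero_le_one (2 - dist z v / η)
  let β : t → K → unitInterval := fun v z => projIcc 0 1 zero_le_one (3 - dist z v / η)
  have α_one : ∀ v z, dist z v.1 ≤ η → α v z = 1 := fun v z h =>
    projIcc_of_right_le _ (by linarith [(div_le_one hη).2 h])
  have β_one : ∀ v z, dist z v.1 ≤ 2 * η → β v z = 1 := fun v z h =>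
    projIcc_of_right_le _ (by linarith [(div_le_iff₀ hη).2 h])
  have α_zero : ∀ v z, 2 * η ≤ dist z v.1 → α v z = 0 := fun v z h =>
    projIcc_of_le_left _ (by linarith [(le_div_iff₀ hη).2 h])
  have of_α : ∀ v z, α v z = 1 → dist z v.1 < 2 * η := fun v z h => by
    by_contra! h'
    exact zero_ne_one ((α_zero v z h').symm.trans h)
  have of_β : ∀ v z, β v z = 1 → dist z v.1 ≤ 2 * η := fun v z h => by
    by_contra! h'
    have h1 : (3 - dist z v.1 / η) < 1 := by linarith [(lt_div_iff₀ hη).2 h']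
    have h2 : ((β v z : unitInterval) : ℝ) = 1 := by rw [h]; rfl
    simp only [β, coe_projIcc] at h2
    have h3 : max 0 (min 1 (3 - dist z v.1 / η)) < 1 :=
      max_lt one_pos ((min_le_right _ _).trans_lt h1)
    exact h3.ne h2
  have of_α' : ∀ z, ∃ v : t, dist z v.1 < η ∧ α v z = 1 := fun z => by
    obtain ⟨v, hv, hzv⟩ := mem_iUnion₂.1 (ht (mem_univ z))
    exact ⟨⟨v, hv⟩, hzv, α_one ⟨v, hv⟩ z (le_of_lt hzv)⟩
  let H : K → Set X := fun z =>
    ⋃ v ∈ {v : t | β v z = 1}, ⋃ w ∈ (univ : Set t), P v w (α v z ⊓ β w z)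
  have H_cont : Continuous[_, TopologicalSpace.vietoris X] H := by
    refine continuous_iUnion_paths (T := fun v : t => T v) (P := fun v w : t => P v w)
      (fun v => ?_) (fun v => ?_) (fun z => (of_α' z).imp fun _ h => h.2) (fun v z => ?_)
      (fun v w => P_cont v w) (fun v w => P_zero v w) fun v w z hv hw => P_one v w ?_
    · exact continuous_projIcc.comp (by fun_prop)
    · exact continuous_projIcc.comp (by fun_prop)
    · rcases le_total (2 * η) (dist z v.1) with h | h
      · exact .inl (α_zero v z h)
      · exact .inr (β_one v z h)
    · linarith [dist_triangle_left v.1 w.1 z, of_α v z hv, of_β w z hw]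
  have T_sub : ∀ (v : t) z, dist z v.1 < η → T v ⊆ H z := fun v z h =>
    (P_near v v (α v z ⊓ β v z)).1.trans <|
      (subset_biUnion_of_mem (u := fun w : t => P v w (α v z ⊓ β w z)) (mem_univ v)).trans <|
        subset_biUnion_of_mem
          (u := fun v : t => ⋃ w ∈ (univ : Set t), P v w (α v z ⊓ β w z))
          (β_one v z (by linarith))
  have H_fin : ∀ z, (H z).Finite := fun z =>
    (toFinite _).biUnion fun v _ => (toFinite _).biUnion fun w _ => (P_near v w _).2.1
  have H_ne : ∀ z, (H z).Nonempty := fun z => by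
    obtain ⟨v, hv, -⟩ := of_α' z
    exact ((f v.1).2.2.image _).mono (T_sub v z hv)
  refine ⟨fun z => ⟨H z, H_fin z, H_ne z⟩, continuous_induced_rng.2 H_cont, fun z => ⟨?_, ?_⟩,
    fun z => ?_⟩
  · intro c hc
    obtain ⟨v, hv, -⟩ := of_α' z
    obtain ⟨a, ha, hca⟩ := (hfη z v (by linarith)).1 c hc
    refine ⟨_, T_sub v z hv (mem_image_of_mem _ ha), ?_⟩
    have h1 := τ_dist v a
    have h2 := e_le v z (by rw [dist_comm]; linarith)
    have h3 := E_le z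
    have h4 := dist_triangle c a (τ (k (f v) + 6) a)
    have h5 := e_pos z
    rw [pow_succ]
    simp only [e] at *
    linarith
  · intro p hp
    obtain ⟨v, hv, hp⟩ := mem_iUnion₂.1 hp
    obtain ⟨w, -, hp⟩ := mem_iUnion₂.1 hp
    obtain ⟨_, ⟨a, ha, rfl⟩, hpa⟩ := (P_near v w _).2.2 p hp
    have hzv : dist z v.1 < 4 * η := by linarith [of_β v z hv]
    obtain ⟨c, hc, hca⟩ := (hfη z v hzv).2 a ha
    refine ⟨c, hc, ?_⟩
    have h1 := τ_dist v a
    have h2 := e_le v z (by rwa [dist_comm])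
    have h3 := E_le z
    have h4 := dist_triangle4 c a (τ (k (f v) + 6) a) p
    have h5 := e_pos z
    rw [dist_comm p] at hpa
    rw [pow_succ]
    simp only [e] at *
    linarith
  · obtain ⟨v, hv, -⟩ := of_α' z
    obtain ⟨a, ha⟩ := (f v.1).2.2
    refine ⟨k (f v) + 6, ?_, a, T_sub v z hv (mem_image_of_mem _ ha)⟩
    have := hk (f z) (f v) <| (hfη z v (by linarith)).mono <| by
      have := E_le z
      simp only [e] at this
      rw [pow_succ]
      linarith
    omega

end FinHyperspace

/-! ### Locally finite families of points from density -/

open Cardinal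

/-- An indexed family of points is locally finite if every point of the space has a neighborhood
containing the members for only finitely many indices. -/
def LocallyFinitePoints {Γ X : Type*} [TopologicalSpace X] (t : Γ → X) : Prop :=
  ∀ p, ∃ N ∈ 𝓝 p, {δ | t δ ∈ N}.Finite

theorem locallyFinitePoints_of_separated {Γ X : Type*} [MetricSpace X] {t : Γ → X} {ε : ℝ}
    (hε : 0 < ε) (ht : ∀ i j, i ≠ j → ε ≤ dist (t i) (t j)) : LocallyFinitePoints t := by
  intro p
  refine ⟨ball p (ε / 2), ball_mem_nhds p (by linarith), Set.Subsingleton.finite ?_⟩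
  intro i hi j hj
  by_contra hij
  have h1 : dist (t i) p < ε / 2 := hi
  have h2 : dist (t j) p < ε / 2 := hj
  linarith [ht i j hij, dist_triangle_right (t i) (t j) p]

/-- Every subset of a metric space contains a maximal `ε`-separated set. -/
theorem exists_maximal_separated {X : Type*} [MetricSpace X] (B : Set X) {ε : ℝ} (hε : 0 < ε) :
    ∃ S ⊆ B, (∀ x ∈ S, ∀ y ∈ S, x ≠ y → ε ≤ dist x y) ∧ ∀ x ∈ B, ∃ y ∈ S, dist x y < ε := by
  obtain ⟨S, hS⟩ := zorn_subset {S : Set X | S ⊆ B ∧ ∀ x ∈ S, ∀ y ∈ S, x ≠ y → ε ≤ dist x y} <| by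
    intro c hc hchain
    refine ⟨⋃₀ c, ⟨sUnion_subset fun s hs => (hc hs).1, ?_⟩, fun s hs => subset_sUnion_of_mem hs⟩
    rintro x ⟨s, hs, hx⟩ y ⟨s', hs', hy⟩ hxy
    rcases hchain.total hs hs' with h | h
    · exact (hc hs').2 x (h hx) y hy hxy
    · exact (hc hs).2 x hx y (h hy) hxy
  refine ⟨S, hS.prop.1, hS.prop.2, fun x hx => ?_⟩
  by_contra! h
  have hxS : x ∈ S := by
    refine hS.le_of_ge (y := insert x S) ⟨insert_subset hx hS.prop.1, ?_⟩ (subset_insert x S)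
      (mem_insert x S)
    rintro a (rfl | ha) b (rfl | hb) hab
    · exact absurd rfl hab
    · exact h b hb
    · rw [dist_comm]; exact h a ha
    · exact hS.prop.2 a ha b hb hab
  exact absurd (h x hxS) (by simpa using hε)

section Density

variable {X : Type u} [MetricSpace X] {κ : Cardinal.{u}}

theorem le_mk_of_subset_closure {U D : Set X} (h : κ ≤ topDensity U) (hDU : D ⊆ U)
    (hD : ∀ x ∈ U, ∀ ε > 0, ∃ y ∈ D, dist x y < ε) : κ ≤ #D := by
  refine h.trans (csInf_le' ⟨Subtype.val ⁻¹' D, ?_, ?_⟩)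
  · intro x
    refine Metric.mem_closure_iff.2 fun ε hε => ?_
    obtain ⟨y, hy, hxy⟩ := hD x x.2 ε hε
    exact ⟨⟨y, hDU hy⟩, hy, hxy⟩
  · exact mk_preimage_of_injective_of_subset_range _ _ Subtype.val_injective
      (by simpa using hDU)

/-- Maximal separated subsets of a set of large density are jointly numerous. -/
theorem exists_separated_le_mk_sigma {U : Set X} (h : κ ≤ topDensity U) :
    ∃ S : ℕ → Set X, (∀ m, S m ⊆ U) ∧ (∀ m, LocallyFinitePoints (Subtype.val : S m → X)) ∧
      κ ≤ #(Σ m, S m) := by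
  choose S hSU hS_sep hS_max using fun m : ℕ =>
    exists_maximal_separated U (ε := 1 / ((m : ℝ) + 1)) (by positivity)
  refine ⟨S, hSU, fun m => locallyFinitePoints_of_separated (ε := 1 / ((m : ℝ) + 1))
    (by positivity) fun i j hij => hS_sep m i i.2 j j.2 (Subtype.coe_ne_coe.2 hij), ?_⟩
  refine (le_mk_of_subset_closure (D := ⋃ m, S m) h (iUnion_subset hSU) fun x hx ε hε => ?_).trans ?_
  · obtain ⟨m, hm⟩ := exists_nat_one_div_lt hε
    obtain ⟨y, hy, hxy⟩ := hS_max m x hx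
    exact ⟨y, mem_iUnion.2 ⟨m, hy⟩, hxy.trans hm⟩
  · exact mk_le_of_surjective (sigmaToiUnion_surjective S)

theorem LocallyFinitePoints.comp {Γ Λ : Type*} {t : Γ → X} (ht : LocallyFinitePoints t)
    {j : Λ → Γ} (hj : Function.Injective j) : LocallyFinitePoints (t ∘ j) := fun p =>
  (ht p).imp fun N hN => ⟨hN.1, Finite.preimage (s := {δ | t δ ∈ N}) hj.injOn hN.2⟩

/-- If countably many separated sets were all smaller than an infinite `Λ`, their sum would have at
most `#Λ < κ` elements. For finite `Λ` a constant family works, since local finiteness counts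
indices. -/
theorem exists_locallyFinitePoints_of_lt {Λ : Type u} (hΛ : #Λ < κ) {U : Set X}
    (hU : U.Nonempty) (h : κ ≤ topDensity U) :
    ∃ t : Λ → X, (∀ i, t i ∈ U) ∧ LocallyFinitePoints t := by
  rcases finite_or_infinite Λ with hfin | hinf
  · exact ⟨fun _ => hU.some, fun _ => hU.some_mem, fun p => ⟨univ, Filter.univ_mem, toFinite _⟩⟩
  obtain ⟨S, hSU, hS, hκ⟩ := exists_separated_le_mk_sigma h
  obtain ⟨m, hm⟩ : ∃ m, #Λ ≤ #(S m) := by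
    by_contra! hlt
    have : #(Σ m, S m) ≤ #Λ := by
      rw [mk_sigma]
      refine (sum_le_lift_mk_mul_iSup _).trans ?_
      refine (mul_le_mul' ?_ (ciSup_le' fun m => (hlt m).le)).trans (mul_eq_self (aleph0_le_mk Λ)).le
      simp
    exact absurd (hκ.trans this) (not_le.2 hΛ)
  obtain ⟨j⟩ := hm
  exact ⟨fun i => j i, fun i => hSU m (j i).2, (hS m).comp j.injective⟩

/-- A sequence in the closed ball with no convergent subsequence meets a small ball about any point
only finitely often; radii tending to `0` pass this on to balls around its terms. -/
theorem exists_locallyFinite_balls {x : X} {r s : ℝ} (hs : s < r)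
    (hx : ¬ IsCompact (closedBall x s)) :
    ∃ (y : ℕ → X) (ρ : ℕ → ℝ), (∀ m, 0 < ρ m) ∧ (∀ m, ball (y m) (ρ m) ⊆ ball x r) ∧
      LocallyFinite fun m => ball (y m) (ρ m) := by
  rw [isCompact_iff_isSeqCompact] at hx
  simp only [IsSeqCompact, not_forall] at hx
  obtain ⟨y, hy, hlim⟩ := hx
  have hclus : ∀ p, ∃ ε > 0, {m | y m ∈ ball p ε}.Finite := by
    intro p
    by_contra! h
    have hp : MapClusterPt p Filter.atTop y := by
      rw [mapClusterPt_iff_frequently]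
      intro N hN
      obtain ⟨ε, hε, hεN⟩ := Metric.mem_nhds_iff.1 hN
      exact (Nat.frequently_atTop_iff_infinite.2 (h ε hε)).mono fun m hm => hεN hm
    obtain ⟨φ, hφ, hlimφ⟩ := hp.tendsto_subseq
    exact hlim ⟨p, isClosed_closedBall.mem_of_tendsto hlimφ (.of_forall fun m => hy _), φ, hφ, hlimφ⟩
  refine ⟨y, fun m => min (r - s) (1 / ((m : ℝ) + 1)), fun m => lt_min (by linarith) (by positivity),
    fun m => ?_, fun p => ?_⟩
  · refine ball_subset_ball' ?_
    linarith [mem_closedBall.1 (hy m), min_le_left (r - s) (1 / ((m : ℝ) + 1))]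
  · obtain ⟨ε, hε, hfin⟩ := hclus p
    obtain ⟨M, hM⟩ := exists_nat_one_div_lt (half_pos hε)
    refine ⟨ball p (ε / 2), ball_mem_nhds p (half_pos hε),
      (hfin.union (finite_lt_nat M)).subset fun m hm => ?_⟩
    rcases lt_or_ge m M with hmM | hmM
    · exact .inr hmM
    obtain ⟨z, hz1, hz2⟩ := hm
    left
    have h1 : dist z (y m) < 1 / ((m : ℝ) + 1) := (mem_ball.1 hz1).trans_le (min_le_right _ _)
    have h2 : 1 / ((m : ℝ) + 1) ≤ 1 / ((M : ℝ) + 1) := by gcongr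
    have h3 := mem_ball.1 hz2
    change dist (y m) p < ε
    linarith [dist_triangle_left (y m) p z]

/-- In a nowhere locally compact metric space all of whose open sets have density at least `κ`,
every ball contains a locally finite family of `κ` points. -/
theorem exists_locallyFinitePoints_ball (hX : NowhereLocallyCompact X)
    (hdens : ∀ x : X, ∀ U ∈ 𝓝 x, κ ≤ topDensity U) {Γ : Type u} (hΓ : #Γ = κ) (x : X) {r : ℝ}
    (hr : 0 < r) : ∃ t : Γ → X, (∀ i, t i ∈ ball x r) ∧ LocallyFinitePoints t := by
  obtain ⟨S, hS_sub, hS, hκ⟩ := exists_separated_le_mk_sigma (hdens x _ (ball_mem_nhds x hr))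
  by_cases! hlarge : ∃ m, κ ≤ #(S m)
  · obtain ⟨m, hm⟩ := hlarge
    rw [← hΓ] at hm
    obtain ⟨j⟩ := hm
    exact ⟨fun i => j i, fun i => hS_sub m (j i).2, (hS m).comp j.injective⟩
  -- No single `S m` need have `κ` elements, for instance when `κ` has countable cofinality. A
  -- family indexed by `S m` is then put into the `m`-th ball of a locally finite sequence, and the
  -- families together are large enough.
  obtain ⟨y, ρ, hρ, hball, hfin⟩ := exists_locallyFinite_balls (half_lt_self hr)
    (hX x _ (closedBall_mem_nhds x (half_pos hr)))
  choose t ht_ball ht using fun m => exists_locallyFinitePoints_of_lt (hlarge m)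
    (nonempty_ball.2 (hρ m)) (hdens (y m) _ (ball_mem_nhds _ (hρ m)))
  rw [← hΓ] at hκ
  obtain ⟨j⟩ := hκ
  have hsigma : LocallyFinitePoints fun i : Σ m, S m => t i.1 i.2 := by
    intro p
    obtain ⟨N, hN, hNfin⟩ := hfin p
    choose N' hN' hN'fin using fun m => ht m p
    refine ⟨N ∩ ⋂ m ∈ {m | (ball (y m) (ρ m) ∩ N).Nonempty}, N' m,
      Filter.inter_mem hN ((Filter.biInter_mem hNfin).2 fun m _ => hN' m), ?_⟩
    refine (hNfin.biUnion fun m _ => (hN'fin m).image (Sigma.mk m)).subset ?_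
    rintro ⟨m, i⟩ ⟨hiN, hi⟩
    have hm : m ∈ {m | (ball (y m) (ρ m) ∩ N).Nonempty} := ⟨_, ht_ball m i, hiN⟩
    exact mem_biUnion hm ⟨i, mem_iInter₂.1 hi m hm, rfl⟩
  exact ⟨fun i => t (j i).1 (j i).2, fun i => hball _ (ht_ball _ _), hsigma.comp j.injective⟩

/-- Points close to every point of the space, forming a family indexed by `Γ` which is locally
finite uniformly in the base point. -/
theorem exists_locallyFinite_marking {Γ : Type*}
    (h : ∀ x : X, ∀ r > 0, ∃ t : Γ → X, (∀ i, t i ∈ ball x r) ∧ LocallyFinitePoints t)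
    {r : ℝ} (hr : 0 < r) :
    ∃ τ : Γ → X → X, (∀ i x, dist x (τ i x) < r) ∧
      ∀ p, ∃ N ∈ 𝓝 p, {i | ∃ x, τ i x ∈ N}.Finite := by
  -- Marks depend on `x` only through a net point `d x`, and lie within `r / 8` of it. The net being
  -- `r / 2`-separated, marks within `r / 8` of `p` come from at most one net point.
  obtain ⟨D, -, hD_sep, hD⟩ := exists_maximal_separated (univ : Set X) (half_pos hr)
  choose d hd_mem hd using fun x => hD x (mem_univ x)
  choose t ht_ball ht using fun x => h x (r / 8) (by linarith)
  refine ⟨fun i x => t (d x) i, fun i x => ?_, fun p => ?_⟩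
  · linarith [dist_triangle_right x (t (d x) i) (d x), hd x, mem_ball.1 (ht_ball (d x) i)]
  by_cases! hp : ∃ c ∈ D, dist p c < r / 4
  · obtain ⟨c, hc, hpc⟩ := hp
    obtain ⟨N, hN, hfin⟩ := ht c p
    refine ⟨N ∩ ball p (r / 8), Filter.inter_mem hN (ball_mem_nhds p (by linarith)),
      hfin.subset ?_⟩
    rintro i ⟨x, hxN, hxp⟩
    have : d x = c := by
      by_contra hne
      linarith [hD_sep _ (hd_mem x) _ hc hne, dist_triangle (d x) p c,
        dist_triangle_left (d x) p (t (d x) i), mem_ball.1 (ht_ball (d x) i), mem_ball.1 hxp]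
    rwa [← this]
  · refine ⟨ball p (r / 8), ball_mem_nhds p (by linarith), (finite_empty).subset ?_⟩
    rintro i ⟨x, hxp⟩
    linarith [hp _ (hd_mem x), dist_triangle_left p (d x) (t (d x) i),
      mem_ball.1 (ht_ball (d x) i), mem_ball.1 hxp]

end Density

/-! ### Discrete families and transfinite choice -/

theorem isDiscreteFamily_of_pairwise_disjoint {Γ Y : Type*} [TopologicalSpace Y] {B : Γ → Set Y}
    (hB : ∀ γ, IsClosed (B γ)) (hdisj : ∀ γ γ', γ ≠ γ' → Disjoint (B γ) (B γ'))
    (hfin : LocallyFinite B) : IsDiscreteFamily B := by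
  intro y
  obtain ⟨V, hV, hVfin⟩ := hfin y
  refine ⟨V ∩ ⋂ γ ∈ {γ | (B γ ∩ V).Nonempty} \ {γ | y ∈ B γ}, (B γ)ᶜ, Filter.inter_mem hV
    ((Filter.biInter_mem (hVfin.subset sdiff_subset)).2 fun γ hγ =>
      (hB γ).isOpen_compl.mem_nhds hγ.2), ?_⟩
  have key : ∀ γ, (B γ ∩ (V ∩ ⋂ γ ∈ {γ | (B γ ∩ V).Nonempty} \ {γ | y ∈ B γ}, (B γ)ᶜ)).Nonempty →
      y ∈ B γ := by
    rintro γ ⟨w, hw, hwV, hw'⟩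
    by_contra hy
    exact mem_iInter₂.1 hw' γ ⟨⟨w, hw, hwV⟩, hy⟩ hw
  intro γ hγ γ' hγ'
  by_contra hne
  exact disjoint_left.1 (hdisj γ γ' hne) (key γ hγ) (key γ' hγ')

/-- Transfinite choice avoiding finite sets determined by the earlier choices. -/
theorem exists_injective_avoiding {Γ : Type u} [Infinite Γ] {S : Γ → Γ → Set Γ}
    (hS : ∀ i j, (S i j).Finite) :
    ∃ σ : Γ → Γ, Function.Injective σ ∧
      ∀ i j, i ≠ j → σ i ∉ S j (σ j) ∨ σ j ∉ S i (σ i) := by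
  -- In a well-order of minimal type every initial segment has fewer than `#Γ` elements, so finite
  -- sets indexed by it cannot cover `Γ`.
  obtain ⟨r, hr, hord⟩ := Cardinal.exists_ord_eq Γ
  have hlt : ∀ i, #{j // r j i} < #Γ := fun i => by
    have := Ordinal.typein_lt_type r i
    rw [← hord, Cardinal.lt_ord] at this
    exact this
  let bad : ∀ i, (∀ j, r j i → Γ) → Set Γ := fun i F =>
    ⋃ j : {j // r j i}, insert (F j j.2) (S j (F j j.2))
  have hbad : ∀ i F, ∃ c, c ∉ bad i F := fun i F => by
    by_contra! h
    have hfin : ∀ j : {j // r j i}, (insert (F j j.2) (S j (F j j.2))).Finite := fun j =>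
      (hS _ _).insert _
    have huniv : bad i F = Set.univ := eq_univ_of_forall h
    rcases finite_or_infinite {j // r j i} with hj | hj
    · exact infinite_univ (α := Γ) (huniv.subst (motive := Set.Finite) (finite_iUnion hfin))
    · have h1 : #(bad i F) ≤ #{j // r j i} := by
        refine (mk_iUnion_le _).trans ?_
        refine (mul_le_mul' le_rfl (ciSup_le' fun j => ((hfin j).lt_aleph0.le.trans
          (aleph0_le_mk {j // r j i})))).trans (mul_eq_self (aleph0_le_mk _)).le
      rw [huniv, mk_univ] at h1
      exact absurd h1 (not_le.2 (hlt i))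
  choose pick hpick using hbad
  let σ : Γ → Γ := hr.wf.fix pick
  have hσ : ∀ i j, r j i → σ i ≠ σ j ∧ σ i ∉ S j (σ j) := fun i j hji => by
    have h1 : σ i ∉ bad i fun j _ => σ j := by
      have : σ i = pick i fun j _ => σ j := hr.wf.fix_eq pick i
      rw [this]
      exact hpick i fun j _ => σ j
    have h2 : σ i ∉ insert (σ j) (S j (σ j)) := fun h => h1 (mem_iUnion.2 ⟨⟨j, hji⟩, h⟩)
    exact ⟨fun h => h2 (.inl h), fun h => h2 (.inr h)⟩
  have htri : ∀ i j, i ≠ j → r i j ∨ r j i := fun i j hij => by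
    rcases trichotomous_of r i j with h | h | h
    · exact .inl h
    · exact absurd h hij
    · exact .inr h
  refine ⟨σ, fun i j hij => ?_, fun i j hij => ?_⟩
  · by_contra hne
    rcases htri i j hne with h | h
    · exact (hσ j i h).1 hij.symm
    · exact (hσ i j h).1 hij
  · rcases htri i j hij with h | h
    · exact .inr (hσ j i h).2
    · exact .inl (hσ i j h).2

/-! ### The discrete cells property -/

namespace FinHyperspace

/-- An open cover determines a scale which varies slowly. -/
theorem exists_scale {X : Type*} [MetricSpace X] {𝒰 : Set (Set (FinHyperspace X))}
    (hopen : ∀ U ∈ 𝒰, IsOpen U) (hcover : ⋃₀ 𝒰 = Set.univ) :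
    ∃ k : FinHyperspace X → ℕ,
      (∀ A B, Near ((1 / 2) ^ (k A + 1)) A B → k B ≤ k A + 1) ∧
      ∀ A, ∃ U ∈ 𝒰, ∀ B, Near ((1 / 2) ^ k A) A B → B ∈ U := by
  classical
  have hex : ∀ A, ∃ m : ℕ, ∃ U ∈ 𝒰, ∀ B, Near ((1 / 2) ^ m) A B → B ∈ U := fun A => by
    obtain ⟨U, hU, hA⟩ := mem_sUnion.1 (hcover.ge (mem_univ A))
    obtain ⟨r, hr, hrU⟩ := (nhds_basis_near A).mem_iff.1 ((hopen U hU).mem_nhds hA)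
    obtain ⟨m, hm⟩ := exists_pow_lt_of_lt_one hr (show (1 / 2 : ℝ) < 1 by norm_num)
    exact ⟨m, U, hU, fun B hB => hrU (hB.mono hm.le)⟩
  refine ⟨fun A => Nat.find (hex A), fun A B hAB => Nat.find_min' _ ?_,
    fun A => Nat.find_spec (hex A)⟩
  -- If `B` is within half the radius of `A`, the half-radius neighborhood of `B` lies in the
  -- neighborhood of `A`, so the same `U` serves `B`.
  obtain ⟨U, hU, h⟩ := Nat.find_spec (hex A)
  refine ⟨U, hU, fun C hC => h C ((hAB.trans hC).mono (le_of_eq ?_))⟩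
  rw [pow_succ]
  ring

theorem subset_mem_nhds {X : Type*} [TopologicalSpace X] {U : Set X} (hU : IsOpen U)
    {A : FinHyperspace X} (hA : A.1 ⊆ U) : {B : FinHyperspace X | B.1 ⊆ U} ∈ 𝓝 A :=
  IsOpen.mem_nhds ⟨_, hU.powerset_vietoris, rfl⟩ hA

/-- Near `A` the scale is at most `k A + 1`, which leaves finitely many `m`, and every point of `B`
is close to one of the finitely many points of `A`. -/
theorem exists_nhds_finite_marks {X Γ : Type*} [MetricSpace X] {k : FinHyperspace X → ℕ}
    (hk : ∀ A B, Near ((1 / 2) ^ (k A + 1)) A B → k B ≤ k A + 1) {τ : ℕ → Γ → X → X}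
    (hτ : ∀ m p, ∃ N ∈ 𝓝 p, {i | ∃ x, τ m i x ∈ N}.Finite) (c : ℕ) (A : FinHyperspace X) :
    ∃ V ∈ 𝓝 A, {i | ∃ B ∈ V, ∃ m ≤ k B + c, ∃ x, τ m i x ∈ B.1}.Finite := by
  choose N hN hfin using hτ
  let U : Set X := ⋃ a ∈ A.1, interior (⋂ m ∈ Iic (k A + 1 + c), N m a)
  have hU : IsOpen U := isOpen_biUnion fun _ _ => isOpen_interior
  have hAU : A.1 ⊆ U := fun a ha => mem_biUnion ha <| mem_interior_iff_mem_nhds.2 <|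
    (Filter.biInter_mem (finite_Iic _)).2 fun m _ => hN m a
  refine ⟨_, Filter.inter_mem (near_mem_nhds (r := (1 / 2) ^ (k A + 1)) (by positivity) A)
    (subset_mem_nhds hU hAU), ?_⟩
  refine (A.2.1.biUnion fun a _ => (finite_Iic (k A + 1 + c)).biUnion fun m _ =>
    hfin m a).subset ?_
  rintro i ⟨B, ⟨hB, hBU⟩, m, hm, x, hx⟩
  obtain ⟨a, ha, hxa⟩ := mem_iUnion₂.1 (hBU hx)
  have hmA : m ∈ Iic (k A + 1 + c) := hm.trans (Nat.add_le_add_right (hk A B hB) c)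
  exact mem_biUnion ha (mem_biUnion hmA ⟨x, mem_iInter₂.1 (interior_subset hxa) m hmA⟩)

theorem discreteCellsProperty {X : Type u} [MetricSpace X]
    (hJ : ∀ x y : X, ∀ r ≤ 1, dist x y < r → JoinedIn (ball x r) x y)
    (hX : NowhereLocallyCompact X) {κ : Cardinal.{u}} (hκ : ℵ₀ ≤ κ)
    (hdens : ∀ x : X, ∀ U ∈ 𝓝 x, κ ≤ topDensity U) (n : ℕ) :
    DiscreteCellsProperty κ n (FinHyperspace X) := by
  intro Γ hΓ 𝒰 hopen hcover f
  have : Infinite Γ := infinite_iff.2 (hΓ ▸ hκ)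
  obtain ⟨k, hk, hkU⟩ := exists_scale hopen hcover
  choose τ τ_dist τ_fin using fun m : ℕ => exists_locallyFinite_marking (Γ := Γ)
    (fun x r hr => exists_locallyFinitePoints_ball hX hdens hΓ x hr)
    (show (0 : ℝ) < (1 / 2) ^ m by positivity)
  have hf : ∀ γ, Continuous fun t : Fin n → unitInterval => f ⟨γ, t⟩ := fun γ =>
    f.continuous.comp continuous_sigmaMk
  choose h h_cont h_near h_mark using fun γ i =>
    exists_near_marked hJ hk (τ := fun m => τ m i) (fun m x => τ_dist m i x) (hf γ)
  -- the marks of index `i` occurring in a set `B`, in the range relevant to `B`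
  let Marks : FinHyperspace X → Set Γ := fun B => {i | ∃ m ≤ k B + 8, ∃ x, τ m i x ∈ B.1}
  have hMarks : ∀ γ i t, i ∈ Marks (h γ i t) := fun γ i t => by
    obtain ⟨m, hm, x, hx⟩ := h_mark γ i t
    refine ⟨m, hm.trans ?_, x, hx⟩
    -- Passing from `f` to `h γ i` can lower the scale by at most one, whence `8 = 7 + 1` in
    -- `Marks`.
    rcases le_total (k (f ⟨γ, t⟩)) (k (h γ i t)) with hle | hle
    · omega
    · have := hk (h γ i t) (f ⟨γ, t⟩) <| (h_near γ i t).symm.mono <|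
        pow_le_pow_of_le_one (by norm_num) (by norm_num) (by omega)
      omega
  have hfin : ∀ A, ∃ V ∈ 𝓝 A, (⋃ B ∈ V, Marks B).Finite := fun A => by
    obtain ⟨V, hV, hVfin⟩ := exists_nhds_finite_marks hk τ_fin 8 A
    refine ⟨V, hV, hVfin.subset fun i hi => ?_⟩
    simpa [Marks] using hi
  have hS : ∀ γ i, (⋃ B ∈ range (h γ i), Marks B).Finite := fun γ i => by
    choose V hV hVfin using hfin
    obtain ⟨s, -, hs⟩ := (isCompact_range (h_cont γ i)).elim_nhds_subcover V fun A _ => hV A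
    refine (s.finite_toSet.biUnion fun A _ => hVfin A).subset ?_
    refine iUnion₂_subset fun B hB => ?_
    obtain ⟨A, hA, hBA⟩ := mem_iUnion₂.1 (hs hB)
    exact fun i hi => mem_biUnion hA (mem_biUnion hBA hi)
  obtain ⟨σ, σ_inj, hσ⟩ := exists_injective_avoiding hS
  refine ⟨⟨fun z => h z.1 (σ z.1) z.2, continuous_sigma fun γ => h_cont γ (σ γ)⟩, ?_, ?_⟩
  · rintro ⟨γ, t⟩
    obtain ⟨U, hU, hUk⟩ := hkU (f ⟨γ, t⟩)
    refine ⟨U, hU, hUk _ ((h_near γ (σ γ) t).mono ?_), hUk _ (near_refl (by positivity) _)⟩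
    exact pow_le_pow_of_le_one (by norm_num) (by norm_num) (Nat.le_succ _)
  · refine isDiscreteFamily_of_pairwise_disjoint
      (fun γ => (isCompact_range (h_cont γ (σ γ))).isClosed) (fun γ γ' hne => ?_) fun A => ?_
    · refine disjoint_left.2 fun B hB hB' => ?_
      -- A common value would carry marks of both indices, while the index chosen later avoids all
      -- marks on the earlier image.
      rcases hσ γ γ' hne with h1 | h1
      · obtain ⟨t, rfl⟩ := hB
        exact h1 (mem_biUnion hB' (hMarks γ (σ γ) t))
      · obtain ⟨t, rfl⟩ := hB'
        exact h1 (mem_biUnion hB (hMarks γ' (σ γ') t))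
    · obtain ⟨V, hV, hVfin⟩ := hfin A
      refine ⟨V, hV, (hVfin.preimage σ_inj.injOn).subset ?_⟩
      rintro γ ⟨_, ⟨t, rfl⟩, htV⟩
      exact mem_biUnion htV (hMarks γ (σ γ) t)

end FinHyperspace

end

theorem proposition6p6 (X : Type u) [TopologicalSpace X] [MetrizableSpace X]
    [LocallyPathConnectedSpace X] (hX : NowhereLocallyCompact X)
    (κ : Cardinal.{u}) (hκ : Cardinal.aleph0 ≤ κ)
    (hdens : ∀ x : X, ∀ U ∈ 𝓝 x, κ ≤ topDensity U) :
    ∀ n : ℕ, DiscreteCellsProperty κ n (FinHyperspace X) := by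
  obtain ⟨m, rfl, hJ⟩ := exists_metricSpace_joinedIn_ball X
  exact FinHyperspace.discreteCellsProperty hJ hX hκ hdens
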